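/- Let $n\in\mathbb N_0$. Functions take values in $\mathbb R\cup\{+\infty\}$, and $0\cdot(+\infty)=0$. For $F,\Phi,\Psi:\mathbb R^n\to\mathbb R\cup\{+\infty\}$ and $\tau\in\mathbb R$ put $\operatorname{dom}F=\{x: F(x)<+\infty\}$, $\operatorname{lev}_\tau F=\{x:F(x)\le\tau\}$, $\operatorname{argmin}F=\{x\in\mathbb R^n: F(x)\le F(y)\text{ for all }y\in\mathbb R^n\}$, and $OP(\Phi,\Psi)=\{\tau\in\mathbb R:\operatorname{dom}\Phi\cap\operatorname{lev}_\tau\Psi\neq\emptyset\}$. $F$ is proper if $F\not\equiv+\infty$. For real $\tau$ and real $\lambda\ge 0$ let $$\mathrm{SOL}(P_{1,\tau})=\{x\in\operatorname{lev}_\tau\Psi:\Phi(x)\le\Phi(y)\text{ for all }y\in\operatorname{lev}_\tau\Psi\},\qquad \mathrm{SOL}(P_{2,\lambda})=\operatorname{argmin}(\Phi+\lambda\Psi).$$ Interior and relative interior are denoted by $\operatorname{int}$ and $\operatorname{ri}$. **Theorem.** i) Let $\Phi,\Psi$ be proper and convex, let $\tau\in(\inf\Psi,+\infty)$ with $\operatorname{ri}(\operatorname{dom}\Phi)\cap\operatorname{ri}(\operatorname{lev}_\tau\Psi)\ne\emptyset$,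 and let $\hat x\in\mathrm{SOL}(P_{1,\tau})\cap\operatorname{int}(\operatorname{dom}\Psi)$. Then there is a real $\lambda\ge0$ with $\hat x\in\mathrm{SOL}(P_{2,\lambda})$. If $\hat x\notin\operatorname{argmin}\Phi$, every such $\lambda$ is positive. ii) Let $\Phi,\Psi$ be proper (not necessarily convex) with $\operatorname{dom}\Phi\cap\operatorname{dom}\Psi\ne\emptyset$, and let $\hat x\in\mathrm{SOL}(P_{2,\lambda})$ for a real $\lambda\ge0$. If $\lambda=0$, then for every $\tau\in OP(\Phi,\Psi)$: $\hat x\in\mathrm{SOL}(P_{1,\tau})$ if and only if $\tau\ge\Psi(\hat x)$. If $\lambda>0$, then $\tau:=\Psi(\hat x)$ is a real number belonging to $OP(\Phi,\Psi)$, and $\hat x\in\mathrm{SOL}(P_{1,\tau})$; if moreover $\Phi,\Psi$ are convex and $\hat x\in\operatorname{int}(\operatorname{dom}\Psi)$, then this $\tau$ is the only value in $OP(\Phi,\Psi)$ with $\hat x\in\mathrm{SOL}(P_{1,\tau})$ if and only if $\hat x\notin\operatorname{argmin}\Phi$. **Corollary.** Let $\Phi,\Psi$ be proper and convex, with $\operatorname{dom}\Psi$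 open and $\operatorname{dom}\Phi\subseteq\operatorname{dom}\Psi$, and let $\hat x\in\mathbb R^n$ belong neither to $\operatorname{argmin}\Phi$ nor to $\operatorname{argmin}\Psi$. (1) If $\hat x\in\mathrm{SOL}(P_{1,\tau})$ for some $\tau\in(\inf\Psi,+\infty)$ with $\operatorname{ri}(\operatorname{dom}\Phi)\cap\operatorname{ri}(\operatorname{lev}_\tau\Psi)\ne\emptyset$, then $\hat x\in\mathrm{SOL}(P_{2,\lambda})$ for some $\lambda>0$. (2) If $\hat x\in\mathrm{SOL}(P_{2,\lambda})$ for some $\lambda>0$, then there is exactly one $\tau\in OP(\Phi,\Psi)$ with $\hat x\in\mathrm{SOL}(P_{1,\tau})$, namely $\tau=\Psi(\hat x)$. -/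

import Mathlib

namespace PenalizedConstrained

/-- Euclidean space `ℝⁿ` (with `n = 0` allowed). -/
abbrev Rn (n : ℕ) : Type := EuclideanSpace ℝ (Fin n)

/-- A proper function `ℝⁿ → ℝ ∪ {+∞}`: the value `-∞` is never taken, and not all values are `+∞`. -/
def IsProper {n : ℕ} (F : Rn n → EReal) : Prop :=
  (∀ x, F x ≠ ⊥) ∧ ∃ x, F x ≠ ⊤

/-- Convexity of a function `ℝⁿ → ℝ ∪ {+∞}`, by Jensen's inequality. In `EReal` one has
`0 * ⊤ = 0`, so the cases `a = 0` and `b = 0` are harmless. It is only used for functions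
that never take the value `⊥`, so no sum `⊤ + ⊥` occurs. -/
def IsConvex {n : ℕ} (F : Rn n → EReal) : Prop :=
  ∀ x y : Rn n, ∀ a b : ℝ, 0 ≤ a → 0 ≤ b → a + b = 1 →
    F (a • x + b • y) ≤ (a : EReal) * F x + (b : EReal) * F y

/-- The effective domain of `F`. -/
def dom {n : ℕ} (F : Rn n → EReal) : Set (Rn n) := {x | F x < ⊤}

/-- The lower level set of `F` to the real level `τ`. -/
def lev {n : ℕ} (τ : ℝ) (F : Rn n → EReal) : Set (Rn n) := {x | F x ≤ (τ : EReal)}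

/-- The set of global minimizers of `F` over the whole of `ℝⁿ`. -/
def argmin {n : ℕ} (F : Rn n → EReal) : Set (Rn n) := {x | ∀ y, F x ≤ F y}

/-- The real levels `τ` for which `dom Φ` and `lev τ Ψ` overlap. -/
def OP {n : ℕ} (Φ Ψ : Rn n → EReal) : Set ℝ := {τ | (dom Φ ∩ lev τ Ψ).Nonempty}

/-- Solutions of the constrained problem: minimize `Φ x` subject to `Ψ x ≤ τ`. -/
def SOL₁ {n : ℕ} (Φ Ψ : Rn n → EReal) (τ : ℝ) : Set (Rn n) :=
  {x | x ∈ lev τ Ψ ∧ ∀ y ∈ lev τ Ψ, Φ x ≤ Φ y}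

/-- Solutions of the penalized problem: minimize `Φ x + l * Ψ x` over `ℝⁿ`,
with the convention `0 * ⊤ = 0` of `EReal`. -/
def SOL₂ {n : ℕ} (Φ Ψ : Rn n → EReal) (l : ℝ) : Set (Rn n) :=
  argmin fun x => Φ x + (l : EReal) * Ψ x

end PenalizedConstrained

/-!
On `dom F` the real-valued function `x ↦ (F x).toReal` is convex, hence continuous in the interior.
So an interior point of `dom Ψ` with `Ψ x < τ` has a neighbourhood inside `lev τ Ψ`, and a solution
of the constrained problem there is a local, hence global, minimizer of `Φ`. A solution outside
`argmin Φ` therefore lies on the boundary `Ψ x = τ`, which gives the uniqueness of the level.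

For the multiplier, a point in the relative interior of `lev τ Ψ` satisfies Slater's condition
`Ψ z < τ`: the segment from a point below `τ` can be prolonged beyond `z` within the level set.
Every feasible point with `Ψ y < τ` bounds the admissible `l` from above, every infeasible point
bounds it from below, and convexity along the segment joining two such points, at the place where
it meets level `τ`, says exactly that the bounds are compatible. A multiplier `l = 0` would make
the solution a local minimizer of `Φ`.
-/

namespace PenalizedConstrained

open Set Filter Topology

theorem exists_mem_openSegment_of_mem_intrinsicInterior {E : Type*} [AddCommGroup E] [Module ℝ E]
    [TopologicalSpace E] [IsTopologicalAddGroup E] [ContinuousSMul ℝ E] {s : Set E} {w z : E}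
    (hz : z ∈ intrinsicInterior ℝ s) (hw : w ∈ s) : ∃ u ∈ s, z ∈ openSegment ℝ w u := by
  obtain ⟨y, hy, rfl⟩ := mem_intrinsicInterior.1 hz
  let line : ℝ → affineSpan ℝ s := fun t =>
    ⟨AffineMap.lineMap w (y : E) t, AffineMap.lineMap_mem t (subset_affineSpan ℝ s hw) y.2⟩
  have line_continuous : Continuous line := AffineMap.lineMap_continuous.subtype_mk _
  have line_one : line 1 = y := Subtype.ext (AffineMap.lineMap_apply_one w (y : E))
  have eventually_mem : ∀ᶠ t in 𝓝 1, (line t : E) ∈ s :=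
    line_continuous.continuousAt.eventually (line_one ▸ mem_interior_iff_mem_nhds.1 hy)
  obtain ⟨t, ht_mem, ht : 1 < t⟩ := ((eventually_mem.filter_mono nhdsWithin_le_nhds).and
    (self_mem_nhdsWithin (s := Ioi (1 : ℝ)))).exists
  refine ⟨line t, ht_mem, ?_⟩
  rw [openSegment_eq_image_lineMap]
  refine ⟨t⁻¹, ⟨by positivity, inv_lt_one_of_one_lt₀ ht⟩, ?_⟩
  rw [AffineMap.lineMap_lineMap_right, inv_mul_cancel₀ (by positivity), AffineMap.lineMap_apply_one]

section LagrangeMultiplier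

variable {E : Type*} [AddCommMonoid E] [SMul ℝ E] {s : Set E} {f g : E → ℝ} {c τ : ℝ}

theorem sub_mul_sub_le_of_convexOn (hf : ConvexOn ℝ s f) (hg : ConvexOn ℝ s g)
    (hc : ∀ x ∈ s, g x ≤ τ → c ≤ f x) {x y : E} (hx : x ∈ s) (hy : y ∈ s)
    (hgx : τ < g x) (hgy : g y < τ) : (c - f x) * (τ - g y) ≤ (f y - c) * (g x - τ) := by
  have hd : 0 < g x - g y := by linarith
  set a := (τ - g y) / (g x - g y) with ha_def
  set b := (g x - τ) / (g x - g y) with hb_def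
  have ha : 0 ≤ a := div_nonneg (by linarith) hd.le
  have hb : 0 ≤ b := div_nonneg (by linarith) hd.le
  have hab : a + b = 1 := by rw [ha_def, hb_def]; field_simp; ring
  have feasible : g (a • x + b • y) ≤ τ := by
    calc g (a • x + b • y) ≤ a * g x + b * g y := hg.2 hx hy ha hb hab
      _ = τ := by rw [ha_def, hb_def]; field_simp; ring
  have key : c ≤ a * f x + b * f y :=
    (hc _ (hf.1 hx hy ha hb hab) feasible).trans (hf.2 hx hy ha hb hab)
  have scaled : c * (g x - g y) ≤ (a * f x + b * f y) * (g x - g y) :=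
    mul_le_mul_of_nonneg_right key hd.le
  have expand : (a * f x + b * f y) * (g x - g y) = (τ - g y) * f x + (g x - τ) * f y := by
    rw [ha_def, hb_def]; field_simp
  linarith

theorem exists_lagrange_multiplier (hf : ConvexOn ℝ s f) (hg : ConvexOn ℝ s g)
    (hc : ∀ x ∈ s, g x ≤ τ → c ≤ f x) (slater : ∃ z ∈ s, g z < τ) :
    ∃ l, 0 ≤ l ∧ ∀ x ∈ s, c ≤ f x + l * (g x - τ) := by
  let lower : Set ℝ := insert 0 ((fun x => (c - f x) / (g x - τ)) '' {x ∈ s | τ < g x})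
  let upper : Set ℝ := (fun y => (f y - c) / (τ - g y)) '' {y ∈ s | g y < τ}
  have lower_le_upper : ∀ p ∈ lower, ∀ q ∈ upper, p ≤ q := by
    rintro _ (rfl | ⟨x, ⟨hx, hgx⟩, rfl⟩) _ ⟨y, ⟨hy, hgy⟩, rfl⟩
    · exact div_nonneg (sub_nonneg.2 (hc y hy hgy.le)) (sub_nonneg.2 hgy.le)
    · exact (div_le_div_iff₀ (sub_pos.2 hgx) (sub_pos.2 hgy)).2
        (sub_mul_sub_le_of_convexOn hf hg hc hx hy hgx hgy)
  obtain ⟨l, hlower, hupper⟩ :=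
    exists_between_of_forall_le (insert_nonempty _ _) (Set.Nonempty.image _ slater) lower_le_upper
  refine ⟨l, hlower (mem_insert _ _), fun x hx => ?_⟩
  rcases lt_trichotomy (g x) τ with hgx | hgx | hgx
  · have := (le_div_iff₀ (sub_pos.2 hgx)).1 (hupper (mem_image_of_mem _ ⟨hx, hgx⟩))
    linarith
  · simpa [hgx] using hc x hx hgx.le
  · have := (div_le_iff₀ (sub_pos.2 hgx)).1
      (hlower (mem_insert_of_mem _ (mem_image_of_mem _ ⟨hx, hgx⟩)))
    linarith

end LagrangeMultiplier

variable {n : ℕ} {F Φ Ψ : Rn n → EReal} {x : Rn n} {l τ : ℝ}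

theorem IsProper.coe_toReal (hF : IsProper F) (hx : x ∈ dom F) : ((F x).toReal : EReal) = F x :=
  EReal.coe_toReal hx.ne (hF.1 x)

theorem IsProper.nonempty_dom (hF : IsProper F) : (dom F).Nonempty :=
  hF.2.imp fun _ => lt_top_iff_ne_top.2

theorem lev_subset_dom : lev τ F ⊆ dom F :=
  fun _ hx => hx.trans_lt (EReal.coe_lt_top τ)

theorem le_of_notMem_dom (hx : x ∉ dom F) {a : EReal} : a ≤ F x :=
  le_top.trans_eq (not_lt_top_iff.1 hx).symm

theorem IsProper.toReal_le_iff (hF : IsProper F) (hx : x ∈ dom F) :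
    (F x).toReal ≤ τ ↔ F x ≤ τ := by
  rw [← EReal.coe_le_coe_iff, hF.coe_toReal hx]

theorem IsProper.toReal_lt_iff (hF : IsProper F) (hx : x ∈ dom F) :
    (F x).toReal < τ ↔ F x < τ := by
  rw [← EReal.coe_lt_coe_iff, hF.coe_toReal hx]

theorem IsConvex.convexOn_toReal (hc : IsConvex F) (hF : IsProper F) :
    ConvexOn ℝ (dom F) fun x => (F x).toReal := by
  have jensen : ∀ ⦃x⦄, x ∈ dom F → ∀ ⦃y⦄, y ∈ dom F → ∀ ⦃a b : ℝ⦄, 0 ≤ a → 0 ≤ b → a + b = 1 →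
      F (a • x + b • y) ≤ ((a * (F x).toReal + b * (F y).toReal : ℝ) : EReal) := by
    intro x hx y hy a b ha hb hab
    rw [EReal.coe_add, EReal.coe_mul, EReal.coe_mul, hF.coe_toReal hx, hF.coe_toReal hy]
    exact hc x y a b ha hb hab
  have convex_dom : Convex ℝ (dom F) := fun x hx y hy a b ha hb hab =>
    lev_subset_dom (jensen hx hy ha hb hab)
  exact ⟨convex_dom, fun x hx y hy a b ha hb hab =>
    (hF.toReal_le_iff (convex_dom hx hy ha hb hab)).2 (jensen hx hy ha hb hab)⟩

theorem IsConvex.mem_argmin_of_isLocalMin (hc : IsConvex F) (hF : IsProper F) (hx : x ∈ dom F)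
    (hmin : IsLocalMin F x) : x ∈ argmin F := by
  have local_min : IsLocalMinOn (fun y => (F y).toReal) (dom F) x := by
    filter_upwards [hmin.filter_mono nhdsWithin_le_nhds, self_mem_nhdsWithin] with y hxy hy
    exact EReal.toReal_le_toReal hxy (hF.1 x) hy.ne
  intro y
  by_cases hy : y ∈ dom F
  · rw [← hF.coe_toReal hy, ← hF.toReal_le_iff hx]
    exact IsMinOn.of_isLocalMinOn_of_convexOn hx local_min (hc.convexOn_toReal hF) hy
  · exact le_of_notMem_dom hy

theorem IsConvex.lev_mem_nhds (hc : IsConvex F) (hF : IsProper F) (hx : x ∈ interior (dom F))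
    (hτ : F x < τ) : lev τ F ∈ 𝓝 x := by
  have interior_mem : interior (dom F) ∈ 𝓝 x := isOpen_interior.mem_nhds hx
  have continuous_at : ContinuousAt (fun y => (F y).toReal) x :=
    (hc.convexOn_toReal hF).continuousOn_interior.continuousAt interior_mem
  filter_upwards [interior_mem, continuous_at.eventually_lt_const
    ((hF.toReal_lt_iff (interior_subset hx)).2 hτ)] with y hy hlt
  exact ((hF.toReal_lt_iff (interior_subset hy)).1 hlt).le

theorem IsConvex.lt_of_mem_intrinsicInterior_lev (hc : IsConvex F) (hF : IsProper F)
    (hτ : ⨅ x, F x < (τ : EReal)) (hx : x ∈ intrinsicInterior ℝ (lev τ F)) : F x < τ := by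
  obtain ⟨w, hw⟩ := iInf_lt_iff.1 hτ
  have w_mem : w ∈ lev τ F := hw.le
  obtain ⟨u, u_mem, hxu⟩ := exists_mem_openSegment_of_mem_intrinsicInterior hx w_mem
  have x_mem : x ∈ dom F := lev_subset_dom (intrinsicInterior_subset hx)
  by_contra! hτx
  have hwx : (F w).toReal < (F x).toReal :=
    (hF.toReal_lt_iff (lev_subset_dom w_mem)).2
      ((hw.trans_le hτx).trans_eq (hF.coe_toReal x_mem).symm)
  have hxu_lt : (F x).toReal < (F u).toReal :=
    (hc.convexOn_toReal hF).lt_right_of_left_lt (lev_subset_dom w_mem) (lev_subset_dom u_mem)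
      hxu hwx
  exact hxu_lt.not_ge (EReal.toReal_le_toReal (u_mem.trans hτx) (hF.1 u) x_mem.ne)

theorem mem_SOL₂_zero_iff : x ∈ SOL₂ Φ Ψ 0 ↔ x ∈ argmin Φ := by
  simp [SOL₂, argmin]

theorem pos_of_mem_SOL₂ (hx : x ∉ argmin Φ) (hl : 0 ≤ l) (h : x ∈ SOL₂ Φ Ψ l) : 0 < l :=
  hl.lt_of_ne (by rintro rfl; exact hx (mem_SOL₂_zero_iff.1 h))

theorem mem_SOL₁_iff_of_mem_argmin (hx : x ∈ argmin Φ) : x ∈ SOL₁ Φ Ψ τ ↔ Ψ x ≤ τ :=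
  ⟨fun h => h.1, fun h => ⟨h, fun y _ => hx y⟩⟩

theorem dom_add_coe_mul (hΦ : IsProper Φ) (hΨ : IsProper Ψ) (hl : 0 < l) :
    dom (fun x => Φ x + l * Ψ x) = dom Φ ∩ dom Ψ := by
  ext x
  have mul_ne_bot : (l : EReal) * Ψ x ≠ ⊥ := by
    simp [EReal.mul_ne_bot, hΨ.1 x, hl.le]
  have mul_ne_top : (l : EReal) * Ψ x ≠ ⊤ ↔ Ψ x ≠ ⊤ := by
    simp [EReal.mul_ne_top, hΨ.1 x, hl.not_ge]
  simp only [dom, mem_ofPred_eq, mem_inter_iff, lt_top_iff_ne_top,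
    EReal.add_ne_top_iff_ne_top₂ (hΦ.1 x) mul_ne_bot, mul_ne_top]

theorem SOL₂_subset_dom_inter_dom (hΦ : IsProper Φ) (hΨ : IsProper Ψ)
    (hne : (dom Φ ∩ dom Ψ).Nonempty) (hl : 0 < l) : SOL₂ Φ Ψ l ⊆ dom Φ ∩ dom Ψ := by
  rw [← dom_add_coe_mul hΦ hΨ hl] at hne ⊢
  obtain ⟨y, hy⟩ := hne
  exact fun x hx => (hx y).trans_lt hy

theorem mem_SOL₂_of_forall_toReal_le (hΦ : IsProper Φ) (hΨ : IsProper Ψ) (hl : 0 < l)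
    (hx : x ∈ dom Φ ∩ dom Ψ)
    (h : ∀ y ∈ dom Φ ∩ dom Ψ,
      (Φ x).toReal + l * (Ψ x).toReal ≤ (Φ y).toReal + l * (Ψ y).toReal) :
    x ∈ SOL₂ Φ Ψ l := by
  have coe_penalized : ∀ y ∈ dom Φ ∩ dom Ψ,
      (((Φ y).toReal + l * (Ψ y).toReal : ℝ) : EReal) = Φ y + l * Ψ y := by
    intro y hy
    rw [EReal.coe_add, EReal.coe_mul, hΦ.coe_toReal hy.1, hΨ.coe_toReal hy.2]
  intro y
  by_cases hy : y ∈ dom Φ ∩ dom Ψ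
  · simpa only [← coe_penalized x hx, ← coe_penalized y hy, EReal.coe_le_coe_iff] using h y hy
  · rw [← dom_add_coe_mul hΦ hΨ hl] at hy
    exact le_of_notMem_dom hy

theorem mem_SOL₁_of_mem_SOL₂ (hl : 0 ≤ l) (hx : x ∈ SOL₂ Φ Ψ l) (hτ : Ψ x = τ) :
    x ∈ SOL₁ Φ Ψ τ := by
  refine ⟨hτ.le, fun y hy => ?_⟩
  have h : Φ x + (l * τ : ℝ) ≤ Φ y + (l * τ : ℝ) :=
    calc Φ x + (l * τ : ℝ) = Φ x + l * Ψ x := by rw [hτ, EReal.coe_mul]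
      _ ≤ Φ y + l * Ψ y := hx y
      _ ≤ Φ y + l * τ := by gcongr; exact hy
      _ = Φ y + (l * τ : ℝ) := by rw [EReal.coe_mul]
  exact (EReal.addLECancellable_coe (l * τ)).add_le_add_iff_right.1 h

theorem mem_argmin_of_mem_SOL₁_of_lt (hΦ : IsProper Φ) (hΦc : IsConvex Φ) (hΨ : IsProper Ψ)
    (hΨc : IsConvex Ψ) (hx : x ∈ SOL₁ Φ Ψ τ) (hΦx : x ∈ dom Φ) (hint : x ∈ interior (dom Ψ))
    (hlt : Ψ x < τ) : x ∈ argmin Φ :=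
  hΦc.mem_argmin_of_isLocalMin hΦ hΦx (mem_of_superset (hΨc.lev_mem_nhds hΨ hint hlt) hx.2)

theorem exists_multiplier_of_mem_SOL₁ (hΦ : IsProper Φ) (hΦc : IsConvex Φ) (hΨ : IsProper Ψ)
    (hΨc : IsConvex Ψ) (slater : ∃ z ∈ dom Φ, Ψ z < τ) (hx : x ∈ SOL₁ Φ Ψ τ) :
    ∃ l : ℝ, 0 ≤ l ∧ ∀ y ∈ dom Φ ∩ dom Ψ,
      (Φ x).toReal ≤ (Φ y).toReal + l * ((Ψ y).toReal - τ) := by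
  have convexOn_Φ := hΦc.convexOn_toReal hΦ
  have convexOn_Ψ := hΨc.convexOn_toReal hΨ
  have convex_inter := convexOn_Φ.1.inter convexOn_Ψ.1
  refine exists_lagrange_multiplier (convexOn_Φ.subset inter_subset_left convex_inter)
    (convexOn_Ψ.subset inter_subset_right convex_inter) (fun y hy hΨy => ?_) ?_
  · exact EReal.toReal_le_toReal (hx.2 y ((hΨ.toReal_le_iff hy.2).1 hΨy)) (hΦ.1 x) hy.1.ne
  · obtain ⟨z, hΦz, hΨz⟩ := slater
    have hz : z ∈ dom Ψ := hΨz.trans (EReal.coe_lt_top τ)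
    exact ⟨z, ⟨hΦz, hz⟩, (hΨ.toReal_lt_iff hz).2 hΨz⟩

theorem exists_mem_SOL₂_of_mem_SOL₁ (hΦ : IsProper Φ) (hΦc : IsConvex Φ) (hΨ : IsProper Ψ)
    (hΨc : IsConvex Ψ) (slater : ∃ z ∈ dom Φ, Ψ z < τ) (hx : x ∈ SOL₁ Φ Ψ τ)
    (hint : x ∈ interior (dom Ψ)) : ∃ l : ℝ, 0 ≤ l ∧ x ∈ SOL₂ Φ Ψ l := by
  by_cases hmin : x ∈ argmin Φ
  · exact ⟨0, le_rfl, mem_SOL₂_zero_iff.2 hmin⟩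
  have hΦx : x ∈ dom Φ := by
    obtain ⟨z, hΦz, hΨz⟩ := slater
    exact (hx.2 z hΨz.le).trans_lt hΦz
  have active : Ψ x = τ := le_antisymm hx.1 <| not_lt.1 fun hlt =>
    hmin (mem_argmin_of_mem_SOL₁_of_lt hΦ hΦc hΨ hΨc hx hΦx hint hlt)
  obtain ⟨l, hl, hle⟩ := exists_multiplier_of_mem_SOL₁ hΦ hΦc hΨ hΨc slater hx
  -- As `0 * ⊤ = 0`, a zero multiplier would leave the points outside `dom Ψ` unpenalized.
  have hl_ne : l ≠ 0 := by
    rintro rfl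
    refine hmin (hΦc.mem_argmin_of_isLocalMin hΦ hΦx ?_)
    filter_upwards [mem_interior_iff_mem_nhds.1 hint] with y hΨy
    by_cases hΦy : y ∈ dom Φ
    · rw [← hΦ.coe_toReal hΦy, ← hΦ.toReal_le_iff hΦx]
      simpa only [zero_mul, add_zero] using hle y ⟨hΦy, hΨy⟩
    · exact le_of_notMem_dom hΦy
  refine ⟨l, hl, mem_SOL₂_of_forall_toReal_le hΦ hΨ (hl.lt_of_ne' hl_ne)
    ⟨hΦx, interior_subset hint⟩ fun y hy => ?_⟩
  have := hle y hy
  rw [active, EReal.toReal_coe]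
  linarith

theorem exists_slater_point (hΨ : IsProper Ψ) (hΨc : IsConvex Ψ) (hτ : ⨅ x, Ψ x < (τ : EReal))
    (hri : (intrinsicInterior ℝ (dom Φ) ∩ intrinsicInterior ℝ (lev τ Ψ)).Nonempty) :
    ∃ z ∈ dom Φ, Ψ z < τ :=
  hri.imp fun _ hz =>
    ⟨intrinsicInterior_subset hz.1, hΨc.lt_of_mem_intrinsicInterior_lev hΨ hτ hz.2⟩

theorem exists_level_of_mem_SOL₂ (hΦ : IsProper Φ) (hΨ : IsProper Ψ)
    (hne : (dom Φ ∩ dom Ψ).Nonempty) (hl : 0 < l) (hx : x ∈ SOL₂ Φ Ψ l) :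
    ∃ τ ∈ OP Φ Ψ, (τ : EReal) = Ψ x ∧ x ∈ SOL₁ Φ Ψ τ := by
  obtain ⟨hΦx, hΨx⟩ := SOL₂_subset_dom_inter_dom hΦ hΨ hne hl hx
  have hτ := hΨ.coe_toReal hΨx
  exact ⟨(Ψ x).toReal, ⟨x, hΦx, hτ.ge⟩, hτ, mem_SOL₁_of_mem_SOL₂ hl.le hx hτ.symm⟩

theorem forall_level_eq_iff_notMem_argmin (hΦ : IsProper Φ) (hΦc : IsConvex Φ) (hΨ : IsProper Ψ)
    (hΨc : IsConvex Ψ) (hΦx : x ∈ dom Φ) (hint : x ∈ interior (dom Ψ)) (hτ : (τ : EReal) = Ψ x) :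
    (∀ τ' ∈ OP Φ Ψ, x ∈ SOL₁ Φ Ψ τ' → τ' = τ) ↔ x ∉ argmin Φ := by
  constructor
  · intro unique hmin
    have hΨx : Ψ x ≤ (τ + 1 : ℝ) := hτ ▸ EReal.coe_le_coe_iff.2 (lt_add_one τ).le
    exact (lt_add_one τ).ne' (unique _ ⟨x, hΦx, hΨx⟩ ((mem_SOL₁_iff_of_mem_argmin hmin).2 hΨx))
  · intro hmin τ' _ hx
    refine le_antisymm (not_lt.1 fun hlt => hmin ?_) (EReal.coe_le_coe_iff.1 (hτ ▸ hx.1))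
    exact mem_argmin_of_mem_SOL₁_of_lt hΦ hΦc hΨ hΨc hx hΦx hint
      (hτ ▸ EReal.coe_lt_coe_iff.2 hlt)

end PenalizedConstrained

open PenalizedConstrained in
theorem mainTheorem7 (n : ℕ) :
    -- Part i)
    (∀ Φ Ψ : Rn n → EReal,
      IsProper Φ → IsConvex Φ → IsProper Ψ → IsConvex Ψ →
      ∀ τ : ℝ, (⨅ x, Ψ x) < (τ : EReal) →
      (intrinsicInterior ℝ (dom Φ) ∩ intrinsicInterior ℝ (lev τ Ψ)).Nonempty →
      ∀ xhat ∈ SOL₁ Φ Ψ τ, xhat ∈ interior (dom Ψ) →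
        (∃ l : ℝ, 0 ≤ l ∧ xhat ∈ SOL₂ Φ Ψ l) ∧
        (xhat ∉ argmin Φ → ∀ l : ℝ, 0 ≤ l → xhat ∈ SOL₂ Φ Ψ l → 0 < l)) ∧
    -- Part ii)
    (∀ Φ Ψ : Rn n → EReal,
      IsProper Φ → IsProper Ψ → (dom Φ ∩ dom Ψ).Nonempty →
      ∀ xhat : Rn n,
        (xhat ∈ SOL₂ Φ Ψ 0 →
          ∀ τ ∈ OP Φ Ψ, (xhat ∈ SOL₁ Φ Ψ τ ↔ Ψ xhat ≤ (τ : EReal))) ∧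
        (∀ l : ℝ, 0 < l → xhat ∈ SOL₂ Φ Ψ l →
          ∃ τ ∈ OP Φ Ψ, (τ : EReal) = Ψ xhat ∧ xhat ∈ SOL₁ Φ Ψ τ ∧
            (IsConvex Φ → IsConvex Ψ → xhat ∈ interior (dom Ψ) →
              ((∀ τ' ∈ OP Φ Ψ, xhat ∈ SOL₁ Φ Ψ τ' → τ' = τ) ↔ xhat ∉ argmin Φ)))) ∧
    -- Corollary
    (∀ Φ Ψ : Rn n → EReal,
      IsProper Φ → IsConvex Φ → IsProper Ψ → IsConvex Ψ →
      IsOpen (dom Ψ) → dom Φ ⊆ dom Ψ →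
      ∀ xhat : Rn n, xhat ∉ argmin Φ → xhat ∉ argmin Ψ →
        (∀ τ : ℝ, (⨅ x, Ψ x) < (τ : EReal) →
          (intrinsicInterior ℝ (dom Φ) ∩ intrinsicInterior ℝ (lev τ Ψ)).Nonempty →
          xhat ∈ SOL₁ Φ Ψ τ → ∃ l : ℝ, 0 < l ∧ xhat ∈ SOL₂ Φ Ψ l) ∧
        (∀ l : ℝ, 0 < l → xhat ∈ SOL₂ Φ Ψ l →
          ∃ τ : ℝ, (τ : EReal) = Ψ xhat ∧ τ ∈ OP Φ Ψ ∧ xhat ∈ SOL₁ Φ Ψ τ ∧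
            ∀ τ' ∈ OP Φ Ψ, xhat ∈ SOL₁ Φ Ψ τ' → τ' = τ)) := by
  refine ⟨fun Φ Ψ hΦ hΦc hΨ hΨc τ hτ hri x hx hint => ⟨?_, ?_⟩,
    fun Φ Ψ hΦ hΨ hne x => ⟨?_, ?_⟩,
    fun Φ Ψ hΦ hΦc hΨ hΨc hopen hsub x hminΦ _ => ⟨?_, ?_⟩⟩
  · exact exists_mem_SOL₂_of_mem_SOL₁ hΦ hΦc hΨ hΨc (exists_slater_point hΨ hΨc hτ hri) hx hint
  · exact fun hmin l hl h => pos_of_mem_SOL₂ hmin hl h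
  · exact fun hx τ _ => mem_SOL₁_iff_of_mem_argmin (mem_SOL₂_zero_iff.1 hx)
  · intro l hl hx
    obtain ⟨τ, hOP, hτ, hx₁⟩ := exists_level_of_mem_SOL₂ hΦ hΨ hne hl hx
    have hΦx := (SOL₂_subset_dom_inter_dom hΦ hΨ hne hl hx).1
    exact ⟨τ, hOP, hτ, hx₁, fun hΦc hΨc hint =>
      forall_level_eq_iff_notMem_argmin hΦ hΦc hΨ hΨc hΦx hint hτ⟩
  · intro τ hτ hri hx
    have hint : x ∈ interior (dom Ψ) := hopen.interior_eq.symm ▸ lev_subset_dom hx.1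
    obtain ⟨l, hl, hx₂⟩ := exists_mem_SOL₂_of_mem_SOL₁ hΦ hΦc hΨ hΨc
      (exists_slater_point hΨ hΨc hτ hri) hx hint
    exact ⟨l, pos_of_mem_SOL₂ hminΦ hl hx₂, hx₂⟩
  · intro l hl hx
    have hne : (dom Φ ∩ dom Ψ).Nonempty := (Set.inter_eq_left.2 hsub).symm ▸ hΦ.nonempty_dom
    obtain ⟨τ, hOP, hτ, hx₁⟩ := exists_level_of_mem_SOL₂ hΦ hΨ hne hl hx
    obtain ⟨hΦx, hΨx⟩ := SOL₂_subset_dom_inter_dom hΦ hΨ hne hl hx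
    exact ⟨τ, hτ, hOP, hx₁, (forall_level_eq_iff_notMem_argmin hΦ hΦc hΨ hΨc hΦx
      (hopen.interior_eq.symm ▸ hΨx) hτ).2 hminΦ⟩
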